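/- Let $L$ be a lattice, i.e. a free abelian group of finite rank with a nondegenerate symmetric $\mathbb Z$-valued bilinear form $\langle\cdot,\cdot\rangle$ (not necessarily positive definite). Put $\mathfrak h=\mathbb C\otimes_{\mathbb Z}L$ with the $\mathbb C$-bilinearly extended form. Let $\hat{\mathfrak h}=\mathbb C[t,t^{-1}]\otimes\mathfrak h\oplus\mathbb C c$ be the affinization, with $h(n)=t^n\otimes h$, $c$ central and $[h(m),g(n)]=m\,\delta_{m+n,0}\langle h,g\rangle c$. For $\lambda\in\mathfrak h$ let $M(1,\lambda)$ be the $\hat{\mathfrak h}$-module induced from the one-dimensional module of $\mathbb C[t]\otimes\mathfrak h\oplus\mathbb C c$ on which $h(n)$ acts by $0$ for $n>0$, $h(0)$ acts by $\langle h,\lambda\rangle$ and $c$ acts by $1$; let $v_\lambda$ be its highest weight vector. As a vector space $M(1,\lambda)\simeq S(t^{-1}\mathbb C[t^{-1}]\otimes\mathfrak h)$. Write $M(1)=M(1,0)$ and $\mathbf 1=v_0$. With $h(z)=\sum_{n\in\mathbb Z}h(n)z^{-n-1}$, $M(1)$ acts on $M(1,\lambda)$ through the vertex operators $Y(u,z)=\sum_{n\in\mathbb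 Z}u_nz^{-n-1}$, linear in $u\in M(1)$ and given by $$Y\bigl(h_1(-n_1)\cdots h_k(-n_k)\mathbf 1,z\bigr)=\;:\!\Bigl(\tfrac{1}{(n_1-1)!}\bigl(\tfrac{d}{dz}\bigr)^{n_1-1}h_1(z)\Bigr)\cdots\Bigl(\tfrac{1}{(n_k-1)!}\bigl(\tfrac{d}{dz}\bigr)^{n_k-1}h_k(z)\Bigr)\!:\qquad(h_i\in\mathfrak h,\ n_i\ge 1),$$ where in the normally ordered product the operators $h(n)$ with $n<0$ stand to the left of those with $n\ge 0$. Let $\omega=\frac12\sum_i h_i(-1)h_i(-1)\mathbf 1$ for an orthonormal basis $(h_i)$ of $\mathfrak h$, let $L_0=\omega_1$ on $M(1)$, and for $r\in\mathbb Z_{\ge 0}$ let $M(1)_r$ be the eigenspace of $L_0$ with eigenvalue $r$. The Schur polynomials $p_r(x_1,x_2,\dots)$ are defined by $$\exp\Bigl(\sum_{n\ge 1}\frac{x_n}{n}y^n\Bigr)=\sum_{r\ge 0}p_r(x_1,x_2,\dots)\,y^r .$$ **Proposition 4.3.** Let $h,\lambda\in\mathfrak h$, $r\in\mathbb Z_{\ge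 0}$ and $u=p_r(h(-1),h(-2),\dots)\mathbf 1\in M(1)$. Then $u\in M(1)_r$, and on $M(1,\lambda)$ 1. $u_nv_\lambda=0$ for all integers $n>r-1$; 2. $u_{r-1}v_\lambda=\binom{\langle\lambda,h\rangle}{r}v_\lambda$, where $\binom{x}{r}=x(x-1)\cdots(x-r+1)/r!$ for $x\in\mathbb C$. -/

import Mathlib

open scoped TensorProduct
open VertexOperator

noncomputable section

namespace HeisenbergVOA

/-! ## Normal ordering of fields

A field on `M` is Mathlib's `VertexOperator ℂ M`, i.e. a series `a(z) = ∑ₙ aₙ z^{-n-1}` with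
`aₙ ∈ End M` and `aₙ v = 0` for `n ≫ 0`; the coefficient `aₙ` is written `a[[n]]`. -/

section Fields

variable {M : Type*} [AddCommGroup M] [Module ℂ M]

theorem field_ext {A B : VertexOperator ℂ M} (h : ∀ n v, (A[[n]]) v = (B[[n]]) v) : A = B := by
  apply HVertexOperator.coeff_inj
  funext n
  ext v
  rw [coeff_eq_ncoeff, coeff_eq_ncoeff]
  exact h (-n - 1) v

theorem field_trunc (A : VertexOperator ℂ M) (v : M) :
    ∃ N : ℤ, ∀ n, N ≤ n → (A[[n]]) v = 0 := by
  refine ⟨-(HahnSeries.order ((HahnModule.of ℂ).symm (A v))), fun n hn => ?_⟩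
  exact ncoeff_eq_zero_of_lt_order A n v (by linarith)

/-- A natural-number truncation bound, uniform over a finite family of vectors. -/
theorem field_trunc_finset (A : VertexOperator ℂ M) (s : Finset ℕ) (f : ℕ → M) (n : ℕ → ℤ) :
    ∃ K : ℕ, ∀ j ∈ s, ∀ i : ℕ, K ≤ i → (A[[n j + i]]) (f j) = 0 := by
  choose N hN using fun j => field_trunc A (f j)
  refine ⟨∑ j ∈ s, (N j - n j).toNat, fun j hj i hi => hN j _ ?_⟩
  have h1 : (N j - n j).toNat ≤ ∑ j ∈ s, (N j - n j).toNat :=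
    Finset.single_le_sum (f := fun j => (N j - n j).toNat) (fun _ _ => Nat.zero_le _) hj
  omega

theorem field_trunc_nat (A : VertexOperator ℂ M) (n : ℤ) (v : M) :
    ∃ K : ℕ, ∀ i : ℕ, K ≤ i → (A[[n + i]]) v = 0 := by
  obtain ⟨K, hK⟩ := field_trunc_finset A {0} (fun _ => v) (fun _ => n)
  exact ⟨K, hK 0 (by simp)⟩

/-- The `n`-th coefficient, applied to `v`, of the normally ordered product
`:a(z) b(z): = a(z)₋ b(z) + b(z) a(z)₊` with
`a(z)₊ = ∑_{j ≥ 0} aⱼ z^{-j-1}` and `a(z)₋ = ∑_{j < 0} aⱼ z^{-j-1}`.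
For fields `a`, `b` both sums are finite. -/
def normalOrderCoeff (A B : VertexOperator ℂ M) (n : ℤ) (v : M) : M :=
  (∑ᶠ i : ℕ, (A[[-1 - (i : ℤ)]]) ((B[[n + i]]) v)) +
    ∑ᶠ j : ℕ, (B[[n - 1 - (j : ℤ)]]) ((A[[(j : ℤ)]]) v)

theorem finsum_nat_eq {M : Type*} [AddCommMonoid M] {f : ℕ → M} {K : ℕ} (h : ∀ i, K ≤ i → f i = 0) :
    ∑ᶠ i, f i = ∑ i ∈ Finset.range K, f i := by
  apply finsum_eq_sum_of_support_subset
  intro i hi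
  simp only [Finset.coe_range, Set.mem_Iio]
  by_contra hc
  exact hi (h i (not_lt.mp hc))

theorem normalOrderCoeff_eq (A B : VertexOperator ℂ M) (n : ℤ) (v : M) (K J : ℕ)
    (hK : ∀ i : ℕ, K ≤ i → (B[[n + i]]) v = 0) (hJ : ∀ j : ℕ, J ≤ j → (A[[(j : ℤ)]]) v = 0) :
    normalOrderCoeff A B n v =
      (∑ i ∈ Finset.range K, (A[[-1 - (i : ℤ)]]) ((B[[n + i]]) v)) +
        ∑ j ∈ Finset.range J, (B[[n - 1 - (j : ℤ)]]) ((A[[(j : ℤ)]]) v) := by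
  rw [normalOrderCoeff, finsum_nat_eq (K := K), finsum_nat_eq (K := J)]
  · intro j hj; rw [hJ j hj, map_zero]
  · intro i hi; rw [hK i hi, map_zero]

theorem exists_bounds (A B : VertexOperator ℂ M) (n : ℤ) (v : M) :
    ∃ K : ℕ, (∀ i : ℕ, K ≤ i → (B[[n + i]]) v = 0) ∧
      ∀ j : ℕ, K ≤ j → (A[[(j : ℤ)]]) v = 0 := by
  obtain ⟨K, hK⟩ := field_trunc_nat B n v
  obtain ⟨J, hJ⟩ := field_trunc_nat A 0 v
  refine ⟨max K J, fun i hi => hK i (le_trans (le_max_left _ _) hi), fun j hj => ?_⟩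
  simpa using hJ j (le_trans (le_max_right _ _) hj)

/-- The normally ordered product `:a(z) b(z):` of two fields. -/
def normalOrder (A B : VertexOperator ℂ M) : VertexOperator ℂ M :=
  VertexOperator.of_coeff
    (fun k =>
      { toFun := normalOrderCoeff A B (-k - 1)
        map_add' := fun v w => by
          obtain ⟨K, hK, hK'⟩ := exists_bounds A B (-k - 1) v
          obtain ⟨J, hJ, hJ'⟩ := exists_bounds A B (-k - 1) w
          have e1 : ∀ i, max K J ≤ i → K ≤ i := fun i h => le_trans (le_max_left _ _) h
          have e2 : ∀ i, max K J ≤ i → J ≤ i := fun i h => le_trans (le_max_right _ _) h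
          rw [normalOrderCoeff_eq A B _ v (max K J) (max K J)
              (fun i hi => hK i (e1 i hi)) (fun i hi => hK' i (e1 i hi)),
            normalOrderCoeff_eq A B _ w (max K J) (max K J)
              (fun i hi => hJ i (e2 i hi)) (fun i hi => hJ' i (e2 i hi)),
            normalOrderCoeff_eq A B _ (v + w) (max K J) (max K J)
              (fun i hi => by rw [map_add, hK i (e1 i hi), hJ i (e2 i hi), add_zero])
              (fun i hi => by rw [map_add, hK' i (e1 i hi), hJ' i (e2 i hi), add_zero])]
          simp only [map_add, Finset.sum_add_distrib]
          abel
        map_smul' := fun c v => by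
          obtain ⟨K, hK, hK'⟩ := exists_bounds A B (-k - 1) v
          rw [normalOrderCoeff_eq A B _ v K K hK hK',
            normalOrderCoeff_eq A B _ (c • v) K K
              (fun i hi => by rw [map_smul, hK i hi, smul_zero])
              (fun i hi => by rw [map_smul, hK' i hi, smul_zero])]
          simp only [map_smul, ← Finset.smul_sum, ← smul_add, RingHom.id_apply] })
    (fun v => by
      obtain ⟨N, hN⟩ := field_trunc B v
      obtain ⟨J, hJ⟩ := field_trunc_nat A 0 v
      obtain ⟨L, hL⟩ := field_trunc_finset B (Finset.range J)
        (fun j => (A[[(j : ℤ)]]) v) (fun j => - 1 - (j : ℤ))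
      refine ⟨-max N L - 1, fun k hk => ?_⟩
      by_contra hlt
      apply hk
      have h1a : N ≤ max N (L : ℤ) := le_max_left _ _
      have h1b : (L : ℤ) ≤ max N (L : ℤ) := le_max_right _ _
      generalize max N (L : ℤ) = m at hlt h1a h1b
      have h1 : k < -m - 1 := not_le.mp hlt
      change normalOrderCoeff A B (-k - 1) v = 0
      rw [normalOrderCoeff_eq A B _ v 0 J (fun i _ => hN _ (by omega))
        (fun j hj => by simpa using hJ j hj)]
      rw [Finset.range_zero, Finset.sum_empty, zero_add]
      apply Finset.sum_eq_zero
      intro j hj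
      have h2 := hL j hj (-k - 1).toNat (by omega)
      rw [← h2, show -k - 1 - 1 - (j : ℤ) = -1 - (j : ℤ) + ((-k - 1).toNat : ℤ) by omega])

theorem normalOrder_apply (A B : VertexOperator ℂ M) (n : ℤ) (v : M) :
    ((normalOrder A B)[[n]]) v = normalOrderCoeff A B n v := by
  rw [normalOrder, ncoeff_of_coeff]
  change normalOrderCoeff A B (-(-n - 1) - 1) v = _
  congr 1
  ring

/-- The normally ordered product as a bilinear map. -/
def normalOrderₗ : VertexOperator ℂ M →ₗ[ℂ] Module.End ℂ (VertexOperator ℂ M) :=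
  LinearMap.mk₂ ℂ normalOrder
    (fun A A' B => field_ext fun n v => by
      obtain ⟨K, hK, hK'⟩ := exists_bounds A B n v
      obtain ⟨J, hJ, hJ'⟩ := exists_bounds A' B n v
      have e1 : ∀ i, max K J ≤ i → K ≤ i := fun i h => le_trans (le_max_left _ _) h
      have e2 : ∀ i, max K J ≤ i → J ≤ i := fun i h => le_trans (le_max_right _ _) h
      simp only [map_add, Pi.add_apply, LinearMap.add_apply, normalOrder_apply]
      rw [normalOrderCoeff_eq A B n v (max K J) (max K J)
          (fun i hi => hK i (e1 i hi)) (fun i hi => hK' i (e1 i hi)),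
        normalOrderCoeff_eq A' B n v (max K J) (max K J)
          (fun i hi => hJ i (e2 i hi)) (fun i hi => hJ' i (e2 i hi)),
        normalOrderCoeff_eq (A + A') B n v (max K J) (max K J)
          (fun i hi => hK i (e1 i hi))
          (fun i hi => by
            rw [map_add, Pi.add_apply, LinearMap.add_apply, hK' i (e1 i hi), hJ' i (e2 i hi),
              add_zero])]
      simp only [map_add, Pi.add_apply, LinearMap.add_apply, Finset.sum_add_distrib]
      abel)
    (fun c A B => field_ext fun n v => by
      obtain ⟨K, hK, hK'⟩ := exists_bounds A B n v
      simp only [map_smul, Pi.smul_apply, LinearMap.smul_apply, normalOrder_apply]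
      rw [normalOrderCoeff_eq A B n v K K hK hK',
        normalOrderCoeff_eq (c • A) B n v K K hK
          (fun i hi => by
            rw [map_smul, Pi.smul_apply, LinearMap.smul_apply, hK' i hi, smul_zero])]
      simp only [map_smul, Pi.smul_apply, LinearMap.smul_apply, Finset.smul_sum, smul_add])
    (fun A B B' => field_ext fun n v => by
      obtain ⟨K, hK, hK'⟩ := exists_bounds A B n v
      obtain ⟨J, hJ, hJ'⟩ := exists_bounds A B' n v
      have e1 : ∀ i, max K J ≤ i → K ≤ i := fun i h => le_trans (le_max_left _ _) h
      have e2 : ∀ i, max K J ≤ i → J ≤ i := fun i h => le_trans (le_max_right _ _) h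
      simp only [map_add, Pi.add_apply, LinearMap.add_apply, normalOrder_apply]
      rw [normalOrderCoeff_eq A B n v (max K J) (max K J)
          (fun i hi => hK i (e1 i hi)) (fun i hi => hK' i (e1 i hi)),
        normalOrderCoeff_eq A B' n v (max K J) (max K J)
          (fun i hi => hJ i (e2 i hi)) (fun i hi => hJ' i (e2 i hi)),
        normalOrderCoeff_eq A (B + B') n v (max K J) (max K J)
          (fun i hi => by
            rw [map_add, Pi.add_apply, LinearMap.add_apply, hK i (e1 i hi), hJ i (e2 i hi),
              add_zero])
          (fun i hi => hK' i (e1 i hi))]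
      simp only [map_add, Pi.add_apply, LinearMap.add_apply, Finset.sum_add_distrib]
      abel)
    (fun c A B => field_ext fun n v => by
      obtain ⟨K, hK, hK'⟩ := exists_bounds A B n v
      simp only [map_smul, Pi.smul_apply, LinearMap.smul_apply, normalOrder_apply]
      rw [normalOrderCoeff_eq A B n v K K hK hK',
        normalOrderCoeff_eq A (c • B) n v K K
          (fun i hi => by
            rw [map_smul, Pi.smul_apply, LinearMap.smul_apply, hK i hi, smul_zero]) hK']
      simp only [map_smul, Pi.smul_apply, LinearMap.smul_apply, Finset.smul_sum, smul_add])

/-- The derivative `∂ a(z) = d/dz a(z)` of a field, with coefficients `(∂a)ₙ = -n a_{n-1}`. -/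
def fieldDerivFun (A : VertexOperator ℂ M) : VertexOperator ℂ M :=
  VertexOperator.of_coeff
    (fun k => (-((-k - 1 : ℤ) : ℂ)) • A[[(-k - 1) - 1]])
    (fun v => by
      obtain ⟨N, hN⟩ := field_trunc A v
      refine ⟨-N - 2, fun k hk => ?_⟩
      by_contra hlt
      have hlt' : k < -N - 2 := not_le.mp hlt
      apply hk
      change (-((-k - 1 : ℤ) : ℂ)) • (A[[(-k - 1) - 1]]) v = 0
      rw [hN _ (by omega), smul_zero])

theorem fieldDerivFun_ncoeff (A : VertexOperator ℂ M) (n : ℤ) :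
    (fieldDerivFun A)[[n]] = (-(n : ℂ)) • A[[n - 1]] := by
  rw [fieldDerivFun, ncoeff_of_coeff]
  rw [show -(-n - 1) - 1 = n by ring]

/-- The derivative of fields as a linear map. -/
def fieldDeriv : Module.End ℂ (VertexOperator ℂ M) where
  toFun := fieldDerivFun
  map_add' A B := field_ext fun n v => by
    simp only [fieldDerivFun_ncoeff, map_add, Pi.add_apply, LinearMap.add_apply,
      LinearMap.smul_apply, smul_add]
  map_smul' c A := field_ext fun n v => by
    simp only [fieldDerivFun_ncoeff, map_smul, Pi.smul_apply, LinearMap.smul_apply,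
      RingHom.id_apply]
    rw [smul_comm]

theorem fieldDeriv_apply (A : VertexOperator ℂ M) (n : ℤ) :
    (fieldDeriv A)[[n]] = (-(n : ℂ)) • A[[n - 1]] :=
  fieldDerivFun_ncoeff A n

/-- The creation parts of two fields commute with each other, and so do the annihilation parts. -/
def PartsCommute (A B : VertexOperator ℂ M) : Prop :=
  (∀ i j : ℤ, i < 0 → j < 0 → ∀ v, (A[[i]]) ((B[[j]]) v) = (B[[j]]) ((A[[i]]) v)) ∧
    ∀ i j : ℤ, 0 ≤ i → 0 ≤ j → ∀ v, (A[[i]]) ((B[[j]]) v) = (B[[j]]) ((A[[i]]) v)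

theorem PartsCommute.symm {A B : VertexOperator ℂ M} (h : PartsCommute A B) : PartsCommute B A :=
  ⟨fun i j hi hj v => (h.1 j i hj hi v).symm, fun i j hi hj v => (h.2 j i hj hi v).symm⟩

theorem PartsCommute.deriv {A B : VertexOperator ℂ M} (h : PartsCommute A B) :
    PartsCommute (fieldDeriv A) B := by
  refine ⟨fun i j hi hj v => ?_, fun i j hi hj v => ?_⟩
  · simp only [fieldDeriv_apply, LinearMap.smul_apply, map_smul]
    rw [h.1 (i - 1) j (by omega) hj]
  · simp only [fieldDeriv_apply, LinearMap.smul_apply, map_smul]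
    rcases hi.eq_or_lt with rfl | hi'
    · simp
    · rw [h.2 (i - 1) j (by omega) hj]

theorem PartsCommute.smul {A B : VertexOperator ℂ M} (h : PartsCommute A B) (c : ℂ) :
    PartsCommute (c • A) B := by
  refine ⟨fun i j hi hj v => ?_, fun i j hi hj v => ?_⟩
  · simp only [map_smul, Pi.smul_apply, LinearMap.smul_apply]
    rw [h.1 i j hi hj]
  · simp only [map_smul, Pi.smul_apply, LinearMap.smul_apply]
    rw [h.2 i j hi hj]

/-- The divided derivative `1/m! (d/dz)^m a(z)`. -/
def dividedDeriv (m : ℕ) : Module.End ℂ (VertexOperator ℂ M) :=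
  ((m.factorial : ℂ)⁻¹) • (fieldDeriv ^ m)

theorem PartsCommute.dividedDeriv {A B : VertexOperator ℂ M} (h : PartsCommute A B) (m : ℕ) :
    PartsCommute (dividedDeriv m A) B := by
  have : PartsCommute ((fieldDeriv ^ m) A) B := by
    induction m with
    | zero => simpa using h
    | succ m ih => rw [pow_succ', Module.End.mul_apply]; exact ih.deriv
  exact this.smul _

/-- `:a (:b f:): = :b (:a f:):` if the creation parts and the annihilation parts of `a` and `b`
commute. -/
theorem normalOrder_comm {A B : VertexOperator ℂ M} (h : PartsCommute A B)
    (F : VertexOperator ℂ M) :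
    normalOrder A (normalOrder B F) = normalOrder B (normalOrder A F) := by
  apply field_ext
  intro n v
  obtain ⟨a, ha⟩ := field_trunc_nat A 0 v
  obtain ⟨b, hb⟩ := field_trunc_nat B 0 v
  obtain ⟨a', ha'⟩ := field_trunc_finset A (Finset.range b) (fun j => (B[[(j : ℤ)]]) v) (fun _ => 0)
  obtain ⟨b', hb'⟩ := field_trunc_finset B (Finset.range a) (fun j => (A[[(j : ℤ)]]) v) (fun _ => 0)
  set J := max (max a b) (max a' b') with hJ
  have hA : ∀ j : ℕ, J ≤ j → (A[[(j : ℤ)]]) v = 0 := fun j hj => by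
    simpa using ha j (by omega)
  have hB : ∀ j : ℕ, J ≤ j → (B[[(j : ℤ)]]) v = 0 := fun j hj => by
    simpa using hb j (by omega)
  have hAB : ∀ i j : ℕ, J ≤ i → (A[[(i : ℤ)]]) ((B[[(j : ℤ)]]) v) = 0 := fun i j hi => by
    by_cases hj : j < b
    · simpa using ha' j (Finset.mem_range.mpr hj) i (by omega)
    · have := hb j (by omega)
      rw [zero_add] at this
      rw [this, map_zero]
  have hBA : ∀ i j : ℕ, J ≤ i → (B[[(i : ℤ)]]) ((A[[(j : ℤ)]]) v) = 0 := fun i j hi => by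
    by_cases hj : j < a
    · simpa using hb' j (Finset.mem_range.mpr hj) i (by omega)
    · have := ha j (by omega)
      rw [zero_add] at this
      rw [this, map_zero]
  obtain ⟨k0, hk0⟩ := field_trunc_nat F n v
  obtain ⟨k1, hk1⟩ := field_trunc_finset F (Finset.range J) (fun j => (A[[(j : ℤ)]]) v)
    (fun j => n - 1 - (j : ℤ))
  obtain ⟨k2, hk2⟩ := field_trunc_finset F (Finset.range J) (fun j => (B[[(j : ℤ)]]) v)
    (fun j => n - 1 - (j : ℤ))
  set K := max k0 (max k1 k2) with hK
  have hF : ∀ i : ℕ, K ≤ i → (F[[n + i]]) v = 0 := fun i hi => hk0 i (by omega)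
  have hFA : ∀ j ∈ Finset.range J, ∀ i : ℕ, K ≤ i →
      (F[[n - 1 - (j : ℤ) + i]]) ((A[[(j : ℤ)]]) v) = 0 :=
    fun j hj i hi => hk1 j hj i (by omega)
  have hFB : ∀ j ∈ Finset.range J, ∀ i : ℕ, K ≤ i →
      (F[[n - 1 - (j : ℤ) + i]]) ((B[[(j : ℤ)]]) v) = 0 :=
    fun j hj i hi => hk2 j hj i (by omega)
  -- expansion of a double normally ordered product
  have key : ∀ (X Y : VertexOperator ℂ M),
      (∀ j : ℕ, J ≤ j → (X[[(j : ℤ)]]) v = 0) → (∀ j : ℕ, J ≤ j → (Y[[(j : ℤ)]]) v = 0) →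
      (∀ i j : ℕ, J ≤ i → (Y[[(i : ℤ)]]) ((X[[(j : ℤ)]]) v) = 0) →
      (∀ j ∈ Finset.range J, ∀ i : ℕ, K ≤ i →
        (F[[n - 1 - (j : ℤ) + i]]) ((X[[(j : ℤ)]]) v) = 0) →
      (∀ j ∈ Finset.range J, ∀ i : ℕ, K ≤ i →
        (F[[n - 1 - (j : ℤ) + i]]) ((Y[[(j : ℤ)]]) v) = 0) →
      ((normalOrder X (normalOrder Y F))[[n]]) v =
        (∑ i ∈ Finset.range K, ∑ k ∈ Finset.range K,
          (X[[-1 - (i : ℤ)]]) ((Y[[-1 - (k : ℤ)]]) ((F[[n + i + k]]) v))) +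
        (∑ i ∈ Finset.range K, ∑ j ∈ Finset.range J,
          (X[[-1 - (i : ℤ)]]) ((F[[n + i - 1 - j]]) ((Y[[(j : ℤ)]]) v))) +
        ((∑ i ∈ Finset.range K, ∑ j ∈ Finset.range J,
          (Y[[-1 - (i : ℤ)]]) ((F[[n + i - 1 - j]]) ((X[[(j : ℤ)]]) v))) +
        ∑ j ∈ Finset.range J, ∑ k ∈ Finset.range J,
          (F[[n - 1 - j - 1 - k]]) ((Y[[(k : ℤ)]]) ((X[[(j : ℤ)]]) v))) := by
    intro X Y hX hY hYX hFX hFY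
    have inner1 : ∀ i : ℕ, ((normalOrder Y F)[[n + i]]) v =
        (∑ k ∈ Finset.range K, (Y[[-1 - (k : ℤ)]]) ((F[[n + i + k]]) v)) +
          ∑ j ∈ Finset.range J, (F[[n + i - 1 - (j : ℤ)]]) ((Y[[(j : ℤ)]]) v) := by
      intro i
      rw [normalOrder_apply, normalOrderCoeff_eq Y F (n + i) v K J _ hY]
      intro k hk
      have := hF (i + k) (by omega)
      push_cast at this
      rwa [← add_assoc] at this
    have inner2 : ∀ j ∈ Finset.range J, ((normalOrder Y F)[[n - 1 - j]]) ((X[[(j : ℤ)]]) v) =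
        (∑ k ∈ Finset.range K,
          (Y[[-1 - (k : ℤ)]]) ((F[[n + k - 1 - j]]) ((X[[(j : ℤ)]]) v))) +
          ∑ k ∈ Finset.range J,
            (F[[n - 1 - j - 1 - (k : ℤ)]]) ((Y[[(k : ℤ)]]) ((X[[(j : ℤ)]]) v)) := by
      intro j hj
      rw [normalOrder_apply, normalOrderCoeff_eq Y F (n - 1 - j) _ K J (hFX j hj)
        (fun i hi => hYX i j hi)]
      congr 1
      refine Finset.sum_congr rfl fun k _ => ?_
      rw [show n - 1 - (j : ℤ) + k = n + k - 1 - j by ring]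
    rw [normalOrder_apply, normalOrderCoeff_eq X (normalOrder Y F) n v K J _ hX]
    · rw [Finset.sum_congr rfl (fun i _ => by rw [inner1 i]), Finset.sum_congr rfl inner2]
      simp only [map_add, map_sum, Finset.sum_add_distrib]
      congr 2
      exact Finset.sum_comm
    · intro i hi
      rw [inner1 i, Finset.sum_eq_zero, Finset.sum_eq_zero, add_zero]
      · intro j hj
        have := hFY j hj i hi
        rwa [show n - 1 - (j : ℤ) + i = n + i - 1 - j by ring] at this
      · intro k _
        have := hF (i + k) (by omega)
        push_cast at this
        rw [← add_assoc] at this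
        rw [this, map_zero]
  rw [key A B hA hB hBA hFA hFB, key B A hB hA hAB hFB hFA]
  have s1 : (∑ i ∈ Finset.range K, ∑ k ∈ Finset.range K,
        (A[[-1 - (i : ℤ)]]) ((B[[-1 - (k : ℤ)]]) ((F[[n + i + k]]) v))) =
      ∑ i ∈ Finset.range K, ∑ k ∈ Finset.range K,
        (B[[-1 - (i : ℤ)]]) ((A[[-1 - (k : ℤ)]]) ((F[[n + i + k]]) v)) := by
    rw [Finset.sum_comm]
    refine Finset.sum_congr rfl fun i _ => Finset.sum_congr rfl fun k _ => ?_
    rw [h.1 _ _ (by omega) (by omega), add_right_comm]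
  have s2 : (∑ j ∈ Finset.range J, ∑ k ∈ Finset.range J,
        (F[[n - 1 - j - 1 - k]]) ((B[[(k : ℤ)]]) ((A[[(j : ℤ)]]) v))) =
      ∑ j ∈ Finset.range J, ∑ k ∈ Finset.range J,
        (F[[n - 1 - j - 1 - k]]) ((A[[(k : ℤ)]]) ((B[[(j : ℤ)]]) v)) := by
    rw [Finset.sum_comm]
    refine Finset.sum_congr rfl fun j _ => Finset.sum_congr rfl fun k _ => ?_
    rw [h.2 _ _ (by omega) (by omega),
      show n - 1 - (k : ℤ) - 1 - j = n - 1 - j - 1 - k by ring]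
  rw [s1, s2]
  abel

end Fields

/-! ## The Heisenberg modules `M(1, λ)` -/

section Fock

variable {H : Type*} [AddCommGroup H] [Module ℂ H]

/-- Algebra maps out of a symmetric algebra, for a linear map with commuting values in a possibly
noncommutative algebra. -/
def symLift {V A : Type*} [AddCommGroup V] [Module ℂ V] [Ring A] [Algebra ℂ A]
    (f : V →ₗ[ℂ] A) (hf : ∀ x y, f x * f y = f y * f x) : SymmetricAlgebra ℂ V →ₐ[ℂ] A :=
  RingCon.liftₐ (TensorAlgebra.symRingCon ℂ V) (TensorAlgebra.lift ℂ f) (by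
    refine RingCon.ringConGen_le.2 (fun x y h' => ?_)
    induction h' with
    | mul_comm x y =>
      rw [RingCon.ker_apply, map_mul, map_mul]
      simpa using hf x y)

theorem symLift_ι {V A : Type*} [AddCommGroup V] [Module ℂ V] [Ring A] [Algebra ℂ A]
    (f : V →ₗ[ℂ] A) (hf : ∀ x y, f x * f y = f y * f x) (x : V) :
    symLift f hf (SymmetricAlgebra.ι ℂ V x) = f x := by
  change TensorAlgebra.lift ℂ f (TensorAlgebra.ι ℂ x) = f x
  simp

variable (H) in
/-- The underlying space `S(ĥ⁻)` of all the modules `M(1, λ)`, where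
`ĥ⁻ = t⁻¹ℂ[t⁻¹] ⊗ H` is written as the space of finitely supported functions `ℕ+ → H`,
the element `h(-n) = t^{-n} ⊗ h` being `Finsupp.single n h`. -/
abbrev Fock : Type _ := SymmetricAlgebra ℂ (ℕ+ →₀ H)

/-- `h(-n)`, `n ≥ 1`, as an element of `S(ĥ⁻)`. -/
def creator (n : ℕ+) : H →ₗ[ℂ] Fock H :=
  SymmetricAlgebra.ι ℂ (ℕ+ →₀ H) ∘ₗ Finsupp.lsingle n

theorem fock_induction {motive : Fock H → Prop} (one : motive 1)
    (creator : ∀ n h a, motive a → motive (creator n h * a))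
    (add : ∀ a b, motive a → motive b → motive (a + b))
    (smul : ∀ (c : ℂ) a, motive a → motive (c • a)) (a : Fock H) : motive a := by
  suffices h : ∀ b, motive b → motive (a * b) by simpa using h 1 one
  induction a using SymmetricAlgebra.induction with
  | algebraMap r => intro b hb; rw [← Algebra.smul_def]; exact smul r b hb
  | ι x =>
    intro b hb
    induction x using Finsupp.induction_linear with
    | zero => rw [map_zero, zero_mul, ← zero_smul ℂ (1 : Fock H)]; exact smul 0 1 one
    | add x y hx hy => rw [map_add, add_mul]; exact add _ _ hx hy
    | single n h => exact creator n h b hb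
  | mul a b ha hb => intro c hc; rw [mul_assoc]; exact ha _ (hb _ hc)
  | add a b ha hb => intro c hc; rw [add_mul]; exact add _ _ (ha _ hc) (hb _ hc)

/-- The algebra map `a ↦ a + ε ∂a` on `S(ĥ⁻)`, where `∂` is the derivation which sends `g(-m)` to
`n δ_{n,m} ⟨h, g⟩`. -/
def annihilatorAux (B : LinearMap.BilinForm ℂ H) (n : ℕ+) (h : H) :
    Fock H →ₐ[ℂ] TrivSqZeroExt (Fock H) (Fock H) :=
  SymmetricAlgebra.lift
    ((TrivSqZeroExt.inlAlgHom ℂ (Fock H) (Fock H)).toLinearMap ∘ₗ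
        SymmetricAlgebra.ι ℂ (ℕ+ →₀ H) +
      (TrivSqZeroExt.inrHom (Fock H) (Fock H)).restrictScalars ℂ ∘ₗ
        Algebra.linearMap ℂ (Fock H) ∘ₗ (((n : ℕ) : ℂ) • B h) ∘ₗ Finsupp.lapply n)

/-- For `n ≥ 1`, the action of `h(n)` on `S(ĥ⁻)`: the derivation which sends `g(-m)` to
`n δ_{n,m} ⟨h, g⟩`. -/
def annihilator (B : LinearMap.BilinForm ℂ H) (n : ℕ+) (h : H) : Module.End ℂ (Fock H) :=
  (TrivSqZeroExt.sndHom (Fock H) (Fock H)).restrictScalars ℂ ∘ₗ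
    (annihilatorAux B n h).toLinearMap

theorem annihilatorAux_fst (B : LinearMap.BilinForm ℂ H) (n : ℕ+) (h : H) (a : Fock H) :
    (annihilatorAux B n h a).fst = a := by
  have : (TrivSqZeroExt.fstHom ℂ (Fock H) (Fock H)).comp (annihilatorAux B n h) =
      AlgHom.id ℂ (Fock H) := by
    apply SymmetricAlgebra.algHom_ext
    ext x
    simp [annihilatorAux]
  exact congrArg (fun f : Fock H →ₐ[ℂ] Fock H => f a) this

theorem annihilator_mul (B : LinearMap.BilinForm ℂ H) (n : ℕ+) (h : H) (a b : Fock H) :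
    annihilator B n h (a * b) = a * annihilator B n h b + annihilator B n h a * b := by
  change (annihilatorAux B n h (a * b)).snd = a * (annihilatorAux B n h b).snd +
    (annihilatorAux B n h a).snd * b
  rw [map_mul, TrivSqZeroExt.snd_mul, annihilatorAux_fst, annihilatorAux_fst]
  simp [mul_comm]

theorem annihilator_one (B : LinearMap.BilinForm ℂ H) (n : ℕ+) (h : H) :
    annihilator B n h 1 = 0 := by
  change (annihilatorAux B n h 1).snd = 0
  simp

theorem annihilator_creator (B : LinearMap.BilinForm ℂ H) (n m : ℕ+) (h g : H) :
    annihilator B n h (creator m g) =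
      algebraMap ℂ (Fock H) (if n = m then ((n : ℕ) : ℂ) * B h g else 0) := by
  change (annihilatorAux B n h (creator m g)).snd = _
  by_cases hnm : n = m
  · subst hnm
    simp [annihilatorAux, creator]
  · simp [annihilatorAux, creator, hnm]

/-- The commutator of an annihilation and a creation operator. -/
theorem annihilator_creator_mul (B : LinearMap.BilinForm ℂ H) (n m : ℕ+) (h g : H) (a : Fock H) :
    annihilator B n h (creator m g * a) = creator m g * annihilator B n h a +
      (if n = m then ((n : ℕ) : ℂ) * B h g else 0) • a := by
  rw [annihilator_mul, annihilator_creator, ← Algebra.smul_def]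

theorem annihilator_comm (B : LinearMap.BilinForm ℂ H) (n m : ℕ+) (h g : H) (a : Fock H) :
    annihilator B n h (annihilator B m g a) = annihilator B m g (annihilator B n h a) := by
  induction a using fock_induction with
  | one => simp [annihilator_one]
  | creator k x a ih =>
    simp only [annihilator_creator_mul, map_add, map_smul, ih]
    abel
  | add a b ha hb => simp only [map_add, ha, hb]
  | smul c a ha => simp only [map_smul, ha]

theorem annihilator_trunc (B : LinearMap.BilinForm ℂ H) (a : Fock H) :
    ∃ N : ℕ, ∀ n : ℕ+, N ≤ n → ∀ h, annihilator B n h a = 0 := by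
  induction a using fock_induction with
  | one => exact ⟨0, fun n _ h => annihilator_one B n h⟩
  | creator k x a ih =>
    obtain ⟨N, hN⟩ := ih
    refine ⟨N + k + 1, fun n hn h => ?_⟩
    have hne : n ≠ k := by rintro rfl; omega
    rw [annihilator_creator_mul, hN n (by omega), if_neg hne, mul_zero, zero_smul, add_zero]
  | add a b ha hb =>
    obtain ⟨N, hN⟩ := ha
    obtain ⟨K, hK⟩ := hb
    exact ⟨N + K, fun n hn h => by rw [map_add, hN n (by omega), hK n (by omega), add_zero]⟩
  | smul c a ha =>
    obtain ⟨N, hN⟩ := ha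
    exact ⟨N, fun n hn h => by rw [map_smul, hN n hn, smul_zero]⟩

/-- `annihilator` is linear in `h`. -/
def annihilatorₗ (B : LinearMap.BilinForm ℂ H) (n : ℕ+) : H →ₗ[ℂ] Module.End ℂ (Fock H) where
  toFun := annihilator B n
  map_add' h g := by
    ext a
    rw [LinearMap.add_apply]
    induction a using fock_induction with
    | one => simp [annihilator_one]
    | creator k x a ih =>
      simp only [annihilator_creator_mul, ih, map_add, LinearMap.add_apply, mul_add]
      split_ifs
      · rw [add_smul]; abel
      · simp
    | add a b ha hb => simp only [map_add, ha, hb]; abel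
    | smul c a ha => simp only [map_smul, ha, smul_add]
  map_smul' c h := by
    ext a
    rw [LinearMap.smul_apply, RingHom.id_apply]
    induction a using fock_induction with
    | one => simp [annihilator_one]
    | creator k x a ih =>
      simp only [annihilator_creator_mul, ih, map_smul, LinearMap.smul_apply, smul_add,
        smul_eq_mul, mul_smul_comm]
      split_ifs
      · rw [smul_smul, mul_left_comm]
      · simp
    | add a b ha hb => simp only [map_add, ha, hb, smul_add]
    | smul d a ha => simp only [map_smul, ha]; rw [smul_comm]

/-- The action of `h(n) = tⁿ ⊗ h` on `M(1, λ)`: for `n < 0` it is the multiplication by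
`h(n) ∈ S(ĥ⁻)`, `h(0)` is the scalar `⟨h, λ⟩`, and for `n > 0` it is the annihilation operator.
The central element `c` acts as `1`. -/
def mode (B : LinearMap.BilinForm ℂ H) (lam : H) : ℤ → H →ₗ[ℂ] Module.End ℂ (Fock H)
  | Int.negSucc k => (LinearMap.mul ℂ (Fock H)) ∘ₗ creator k.succPNat
  | Int.ofNat 0 => LinearMap.smulRight (B.flip lam) 1
  | Int.ofNat (k + 1) => annihilatorₗ B k.succPNat

theorem mode_neg (B : LinearMap.BilinForm ℂ H) (lam h : H) (n : ℕ+) (a : Fock H) :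
    mode B lam (-(n : ℤ)) h a = creator n h * a := by
  obtain ⟨k, rfl⟩ : ∃ k : ℕ, k.succPNat = n := ⟨n.natPred, by simp⟩
  rfl

theorem mode_zero (B : LinearMap.BilinForm ℂ H) (lam h : H) (a : Fock H) :
    mode B lam 0 h a = B h lam • a := rfl

theorem mode_pos (B : LinearMap.BilinForm ℂ H) (lam h : H) (n : ℕ+) (a : Fock H) :
    mode B lam (n : ℤ) h a = annihilator B n h a := by
  obtain ⟨k, rfl⟩ : ∃ k : ℕ, k.succPNat = n := ⟨n.natPred, by simp⟩
  rfl

theorem int_cases (n : ℤ) : (∃ k : ℕ+, n = -(k : ℤ)) ∨ n = 0 ∨ ∃ k : ℕ+, n = (k : ℤ) := by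
  rcases lt_trichotomy n 0 with h | h | h
  · exact Or.inl ⟨⟨n.natAbs, by omega⟩, by rw [PNat.mk_coe]; omega⟩
  · exact Or.inr (Or.inl h)
  · exact Or.inr (Or.inr ⟨⟨n.natAbs, by omega⟩, by rw [PNat.mk_coe]; omega⟩)

/-- The Heisenberg relations `[h(m), g(n)] = m δ_{m+n,0} ⟨h, g⟩ c` with `c = 1`: the operators
`h(n)` make the Fock space a module over the affinization `ĥ`. -/
theorem mode_comm (B : LinearMap.BilinForm ℂ H) (hB : B.IsSymm) (lam h g : H) (m n : ℤ)
    (a : Fock H) :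
    mode B lam m h (mode B lam n g a) - mode B lam n g (mode B lam m h a) =
      (if m + n = 0 then (m : ℂ) * B h g else 0) • a := by
  have hs : B g h = B h g := hB.eq g h
  rcases int_cases m with ⟨m, rfl⟩ | rfl | ⟨m, rfl⟩ <;>
  rcases int_cases n with ⟨n, rfl⟩ | rfl | ⟨n, rfl⟩
  · have : -(m : ℤ) + -(n : ℤ) ≠ 0 := by have := m.pos; have := n.pos; omega
    rw [if_neg this]
    simp only [mode_neg]
    rw [mul_left_comm, sub_self, zero_smul]
  · have : -(m : ℤ) + 0 ≠ 0 := by have := m.pos; omega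
    rw [if_neg this]
    simp only [mode_neg, mode_zero]
    rw [mul_smul_comm, sub_self, zero_smul]
  · simp only [mode_neg, mode_pos, annihilator_creator_mul]
    by_cases hmn : n = m
    · subst hmn
      simp [hs]
    · have : -(m : ℤ) + (n : ℤ) ≠ 0 := by
        intro h0; apply hmn; apply PNat.coe_injective; omega
      simp [hmn, this]
  · have : 0 + -(n : ℤ) ≠ 0 := by have := n.pos; omega
    rw [if_neg this]
    simp only [mode_neg, mode_zero]
    rw [mul_smul_comm, sub_self, zero_smul]
  · simp only [mode_zero, map_smul]
    rw [smul_comm (B g lam), sub_self]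
    simp
  · simp [mode_zero, mode_pos]
  · simp only [mode_neg, mode_pos, annihilator_creator_mul]
    by_cases hmn : m = n
    · subst hmn
      simp
    · have : (m : ℤ) + -(n : ℤ) ≠ 0 := by
        intro h0; apply hmn; apply PNat.coe_injective; omega
      simp [hmn, this]
  · simp [mode_zero, mode_pos]
  · have : (m : ℤ) + (n : ℤ) ≠ 0 := by have := m.pos; have := n.pos; omega
    rw [if_neg this]
    simp only [mode_pos]
    rw [annihilator_comm, sub_self, zero_smul]

variable (H) in
/-- The highest weight vector `v_λ = 1 ⊗ 1` of `M(1, λ)`; for `λ = 0` it is the vacuum `𝟏`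
of `M(1)`. -/
def hwVector : Fock H := 1

theorem mode_hwVector (B : LinearMap.BilinForm ℂ H) (lam h : H) (n : ℤ) (hn : 0 ≤ n) :
    mode B lam n h (hwVector H) = (if n = 0 then B h lam else 0) • hwVector H := by
  rcases int_cases n with ⟨n, rfl⟩ | rfl | ⟨n, rfl⟩
  · have := n.pos; omega
  · simp [mode_zero]
  · rw [mode_pos, hwVector, annihilator_one, if_neg (by have := n.pos; omega), zero_smul]

/-- The Fock space with the operators `mode B lam` is the induced module
`M(1, λ) = U(ĥ) ⊗_{U(ℂ[t] ⊗ H ⊕ ℂ c)} ℂ_λ`: it has the universal property of that module among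
the `ĥ`-modules of level one. -/
theorem fock_universal (B : LinearMap.BilinForm ℂ H) (lam : H)
    {N : Type*} [AddCommGroup N] [Module ℂ N] (a : ℤ → H →ₗ[ℂ] Module.End ℂ N)
    (ha : ∀ m n h g v, a m h (a n g v) - a n g (a m h v) =
      (if m + n = 0 then (m : ℂ) * B h g else 0) • v)
    (w : N) (hw : ∀ n h, 0 ≤ n → a n h w = (if n = 0 then B h lam else 0) • w) :
    ∃! φ : Fock H →ₗ[ℂ] N, φ (hwVector H) = w ∧
      ∀ n h f, φ (mode B lam n h f) = a n h (φ f) := by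
  let T : (ℕ+ →₀ H) →ₗ[ℂ] Module.End ℂ N :=
    Finsupp.lsum ℂ (fun n : ℕ+ => a (-(n : ℤ)))
  have hT : ∀ x y, T x * T y = T y * T x := by
    intro x y
    induction x using Finsupp.induction_linear with
    | zero => simp
    | add x x' hx hx' => rw [map_add, add_mul, mul_add, hx, hx']
    | single m h =>
      induction y using Finsupp.induction_linear with
      | zero => simp
      | add y y' hy hy' => rw [map_add, add_mul, mul_add, hy, hy']
      | single n g =>
        ext v
        have h1 : -(m : ℤ) + -(n : ℤ) ≠ 0 := by have := m.pos; have := n.pos; omega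
        have h2 := ha (-(m : ℤ)) (-(n : ℤ)) h g v
        rw [if_neg h1, zero_smul, sub_eq_zero] at h2
        simpa [T] using h2
  let φ : Fock H →ₗ[ℂ] N := (LinearMap.applyₗ w) ∘ₗ (symLift T hT).toLinearMap
  have hφ1 : φ 1 = w := by simp [φ]
  have hφc : ∀ n h f, φ (creator n h * f) = a (-(n : ℤ)) h (φ f) := by
    intro n h f
    simp [φ, creator, symLift_ι, T]
  refine ⟨φ, ⟨hφ1, fun n h f => ?_⟩, ?_⟩
  · rcases int_cases n with ⟨n, rfl⟩ | hn
    · rw [mode_neg, hφc]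
    · have hn0 : 0 ≤ n := by
        rcases hn with rfl | ⟨k, rfl⟩
        · rfl
        · positivity
      induction f using fock_induction with
      | one =>
        have := mode_hwVector B lam h n hn0
        rw [hwVector] at this
        rw [this, map_smul, hφ1, hw n h hn0]
      | creator k g f ih =>
        have h1 : mode B lam n h (creator k g * f) = creator k g * mode B lam n h f +
            (if n + -(k : ℤ) = 0 then (n : ℂ) * B h g else 0) • f := by
          rcases hn with rfl | ⟨n, rfl⟩
          · simp [mode_zero]
          · rw [mode_pos, mode_pos, annihilator_creator_mul]
            by_cases hnk : n = k
            · subst hnk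
              simp
            · have : (n : ℤ) + -(k : ℤ) ≠ 0 := by
                intro h0; apply hnk; apply PNat.coe_injective; omega
              simp [hnk, this]
        rw [h1, map_add, map_smul, hφc, hφc, ih, ← ha]
        abel
      | add f g hf hg => simp only [map_add, hf, hg]
      | smul c f hf => simp only [map_smul, hf]
  · rintro ψ ⟨hψ1, hψ⟩
    ext f
    induction f using fock_induction with
    | one => rw [hφ1]; exact hψ1
    | creator k g f ih => rw [hφc, ← ih, ← hψ, mode_neg]
    | add f g hf hg => simp only [map_add, hf, hg]
    | smul c f hf => simp only [map_smul, hf]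

/-! ## The vertex operators -/

/-- The field `h(z) = ∑ₙ h(n) z^{-n-1}` on `M(1, λ)`. -/
def heisFieldFun (B : LinearMap.BilinForm ℂ H) (lam h : H) : VertexOperator ℂ (Fock H) :=
  VertexOperator.of_coeff (fun k => mode B lam (-k - 1) h) (fun v => by
    obtain ⟨N, hN⟩ := annihilator_trunc B v
    refine ⟨-N - 2, fun k hk => ?_⟩
    by_contra hlt
    have hlt' : k < -N - 2 := not_le.mp hlt
    apply hk
    obtain ⟨n, hn⟩ : ∃ n : ℕ+, -k - 1 = (n : ℤ) :=
      ⟨⟨(-k - 1).toNat, by omega⟩, by simp; omega⟩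
    change mode B lam (-k - 1) h v = 0
    rw [hn, mode_pos, hN n (by omega)])

theorem heisFieldFun_ncoeff (B : LinearMap.BilinForm ℂ H) (lam h : H) (n : ℤ) :
    (heisFieldFun B lam h)[[n]] = mode B lam n h := by
  rw [heisFieldFun, ncoeff_of_coeff]
  rw [show -(-n - 1) - 1 = n by ring]

/-- The field `h(z)` on `M(1, λ)`, linear in `h`. -/
def heisField (B : LinearMap.BilinForm ℂ H) (lam : H) :
    H →ₗ[ℂ] VertexOperator ℂ (Fock H) where
  toFun := heisFieldFun B lam
  map_add' h g := field_ext fun n v => by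
    simp only [heisFieldFun_ncoeff, map_add, Pi.add_apply, LinearMap.add_apply]
  map_smul' c h := field_ext fun n v => by
    simp only [heisFieldFun_ncoeff, map_smul, Pi.smul_apply, LinearMap.smul_apply,
      RingHom.id_apply]

theorem heisField_ncoeff (B : LinearMap.BilinForm ℂ H) (lam h : H) (n : ℤ) :
    (heisField B lam h)[[n]] = mode B lam n h :=
  heisFieldFun_ncoeff B lam h n

theorem heisField_partsCommute (B : LinearMap.BilinForm ℂ H) (lam h g : H) :
    PartsCommute (heisField B lam h) (heisField B lam g) := by
  refine ⟨fun i j hi hj v => ?_, fun i j hi hj v => ?_⟩ <;>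
    rw [heisField_ncoeff, heisField_ncoeff] <;>
    rcases int_cases i with ⟨i, rfl⟩ | rfl | ⟨i, rfl⟩ <;>
    rcases int_cases j with ⟨j, rfl⟩ | rfl | ⟨j, rfl⟩ <;>
    first
    | (exfalso; have := i.pos; omega)
    | (exfalso; have := j.pos; omega)
    | (exfalso; omega)
    | (simp only [mode_neg]; rw [mul_left_comm])
    | (simp only [mode_pos]; rw [annihilator_comm])
    | (simp only [mode_zero]; rw [smul_comm])
    | (simp only [mode_zero, map_smul])

theorem idField_bddBelow (v : Fock H) :
    BddBelow (Function.support
      fun k : ℤ => (if k = 0 then 1 else 0 : Module.End ℂ (Fock H)) v) := by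
  refine ⟨0, fun k hk => ?_⟩
  by_contra hlt
  have hlt' : k < 0 := not_le.mp hlt
  apply hk
  change (if k = 0 then 1 else 0 : Module.End ℂ (Fock H)) v = 0
  rw [if_neg hlt'.ne, LinearMap.zero_apply]

/-- The field `Y(𝟏, z) = Id`, whose only nonzero coefficient is that of `z^0`. -/
def idField : VertexOperator ℂ (Fock H) :=
  VertexOperator.of_coeff (fun k => if k = 0 then 1 else 0) idField_bddBelow

theorem idField_ncoeff (n : ℤ) :
    (idField (H := H))[[n]] = if n = -1 then 1 else 0 := by
  rw [idField, ncoeff_of_coeff]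
  congr 1
  simp only [eq_iff_iff]
  omega

/-- The linear map which sends `h(-m)` to the operator
`F(z) ↦ :(1/(m-1)! (d/dz)^{m-1} h(z)) F(z):` on fields. -/
def normalOrderStep (B : LinearMap.BilinForm ℂ H) (lam : H) :
    (ℕ+ →₀ H) →ₗ[ℂ] Module.End ℂ (VertexOperator ℂ (Fock H)) :=
  Finsupp.lsum ℂ
    (fun m : ℕ+ => normalOrderₗ ∘ₗ dividedDeriv ((m : ℕ) - 1) ∘ₗ heisField B lam)

theorem normalOrderStep_single (B : LinearMap.BilinForm ℂ H) (lam h : H) (m : ℕ+)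
    (F : VertexOperator ℂ (Fock H)) :
    normalOrderStep B lam (Finsupp.single m h) F =
      normalOrder (dividedDeriv ((m : ℕ) - 1) (heisField B lam h)) F := by
  simp [normalOrderStep, normalOrderₗ]

theorem normalOrderStep_comm (B : LinearMap.BilinForm ℂ H) (lam : H) (x y : ℕ+ →₀ H) :
    normalOrderStep B lam x * normalOrderStep B lam y =
      normalOrderStep B lam y * normalOrderStep B lam x := by
  induction x using Finsupp.induction_linear with
  | zero => simp
  | add x x' hx hx' => rw [map_add, add_mul, mul_add, hx, hx']
  | single m h =>
    induction y using Finsupp.induction_linear with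
    | zero => simp
    | add y y' hy hy' => rw [map_add, add_mul, mul_add, hy, hy']
    | single n g =>
      refine LinearMap.ext fun F => ?_
      simp only [Module.End.mul_apply, normalOrderStep_single]
      apply normalOrder_comm
      exact (((heisField_partsCommute B lam h g).dividedDeriv _).symm.dividedDeriv _).symm

/-- The action of `S(ĥ⁻)` on fields by normally ordered products. -/
def normalOrderAction (B : LinearMap.BilinForm ℂ H) (lam : H) :
    Fock H →ₐ[ℂ] Module.End ℂ (VertexOperator ℂ (Fock H)) :=
  symLift (A := Module.End ℂ (VertexOperator ℂ (Fock H))) (normalOrderStep B lam)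
    (normalOrderStep_comm B lam)

/-- The vertex operator `Y(u, z)` on `M(1, λ)` for `u ∈ M(1)`. It is linear in `u`, and
`u = h₁(-n₁) ⋯ h_k(-n_k) 𝟏` is sent to the normally ordered product
`:(1/(n₁-1)! (d/dz)^{n₁-1} h₁(z)) ⋯ (1/(n_k-1)! (d/dz)^{n_k-1} h_k(z)):`
(see `vertexOp_one` and `vertexOp_creator_mul`). -/
def vertexOp (B : LinearMap.BilinForm ℂ H) (lam : H) :
    Fock H →ₗ[ℂ] VertexOperator ℂ (Fock H) where
  toFun u := normalOrderAction B lam u idField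
  map_add' u v := by rw [map_add]; rfl
  map_smul' c u := by rw [map_smul]; rfl

theorem vertexOp_one (B : LinearMap.BilinForm ℂ H) (lam : H) :
    vertexOp B lam 1 = idField := by
  change normalOrderAction B lam 1 idField = _
  rw [map_one, Module.End.one_apply]

theorem vertexOp_creator_mul (B : LinearMap.BilinForm ℂ H) (lam h : H) (m : ℕ+) (u : Fock H) :
    vertexOp B lam (creator m h * u) =
      normalOrder (dividedDeriv ((m : ℕ) - 1) (heisField B lam h)) (vertexOp B lam u) := by
  change normalOrderAction B lam
    (SymmetricAlgebra.ι ℂ (ℕ+ →₀ H) (Finsupp.single m h) * u) idField = _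
  rw [map_mul, normalOrderAction, symLift_ι, Module.End.mul_apply, normalOrderStep_single]
  rfl

/-- The conformal vector `ω = 1/2 ∑ᵢ hᵢ(-1) hᵢ(-1) 𝟏` of `M(1)`, for an (orthonormal) basis
`hᵢ` of `H`. -/
def conformalVector {d : ℕ} (b : Module.Basis (Fin d) ℂ H) : Fock H :=
  (1 / 2 : ℂ) • ∑ i, creator 1 (b i) * (creator 1 (b i) * hwVector H)

/-- `L₀` on `M(1)`, where `Y(ω, z) = ∑ₙ Lₙ z^{-n-2}`; so `Lₙ = ω_{n+1}`. -/
def L0 (B : LinearMap.BilinForm ℂ H) {d : ℕ} (b : Module.Basis (Fin d) ℂ H) :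
    Module.End ℂ (Fock H) :=
  (vertexOp B 0 (conformalVector b))[[1]]

/-- The homogeneous component `M(1)ₙ`, the eigenspace of `L₀` with eigenvalue `n`. -/
def gradedPart (B : LinearMap.BilinForm ℂ H) {d : ℕ} (b : Module.Basis (Fin d) ℂ H) (n : ℕ) :
    Submodule ℂ (Fock H) :=
  Module.End.eigenspace (L0 B b) (n : ℂ)

end Fock

/-! ## Schur polynomials -/

/-- The series `∑_{n ≥ 1} (xₙ / n) yⁿ` in `y`. -/
def schurExponent : PowerSeries (MvPolynomial ℕ+ ℂ) :=
  PowerSeries.mk fun n =>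
    if hn : 0 < n then (1 / (n : ℂ)) • MvPolynomial.X (⟨n, hn⟩ : ℕ+) else 0

/-- The exponential `exp f` may be formed, since `f` has no constant term. -/
theorem hasSubst_schurExponent : PowerSeries.HasSubst schurExponent :=
  PowerSeries.HasSubst.of_constantCoeff_zero' (by
    rw [← PowerSeries.coeff_zero_eq_constantCoeff_apply]
    simp [schurExponent])

/-- The Schur polynomials `p_r(x₁, x₂, …)`, with
`exp (∑_{n ≥ 1} (xₙ / n) yⁿ) = ∑_{r ≥ 0} p_r(x₁, x₂, …) y^r`. -/
def schurPoly (r : ℕ) : MvPolynomial ℕ+ ℂ :=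
  PowerSeries.coeff r ((PowerSeries.exp (MvPolynomial ℕ+ ℂ)).subst schurExponent)

/-- The element `f(h(-1), h(-2), …) 𝟏` of `M(1)`. -/
def evalAtModes {H : Type*} [AddCommGroup H] [Module ℂ H] (h : H) (f : MvPolynomial ℕ+ ℂ) :
    Fock H :=
  MvPolynomial.aeval (fun n : ℕ+ => creator n h) f * hwVector H

end HeisenbergVOA

end

open HeisenbergVOA

namespace HeisenbergVOA

/-! ## Recursions for Schur polynomials and binomial coefficients -/

/-! Differentiating the generating series gives the recursion (r+1) p_{r+1} = ∑_{i+m=r} x_{m+1} p_i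
(`schurPoly_succ`). Both claims about u = p_r(h(-1), h(-2), …)𝟏 follow it by strong induction,
through `evalAtModes_schurPoly_induction`.

For the action on v_λ, multiplication of u by h(-m-1) puts the field (1/m!) ∂^m h(z) in front of
Y(u, z) in a normally ordered product. Among the coefficients of this field with index j ≥ 0, only j
= m acts nontrivially on v_λ, and it acts by the scalar (-1)^m ⟨h, λ⟩
(`dividedDeriv_heisField_one`). The creation half contributes nothing in the relevant range, because
there the coefficients of Y(u, z) already kill v_λ. So the top coefficient is multiplied by (-1)^m
⟨h, λ⟩ (`HasTopCoeff.creator_mul`): in effect x_n is replaced by (-1)^{n-1} a with a = ⟨h, λ⟩. Since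
exp(a log(1+y)) = (1+y)^a, the result is the binomial coefficient; on the level of recursions this
is `sum_antidiagonal_choose`.

For the grading, on M(1) one has L₀ = ∑_i ∑_{n≥1} h_i(-n) h_i(n) (`L0_apply`). Hence [L₀, h(-k)] = k
h(-k) (`L0_creator_mul`), and every term of the recursion has the same weight. -/

theorem schurPoly_zero : schurPoly 0 = 1 := by
  -- The exponent has no constant term, so none of its positive powers contributes in degree 0.
  rw [schurPoly, PowerSeries.coeff_subst' hasSubst_schurExponent, finsum_eq_single _ 0]
  · simp
  · intro d hd
    have h0 : PowerSeries.constantCoeff schurExponent = 0 := by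
      rw [← PowerSeries.coeff_zero_eq_constantCoeff_apply]
      simp [schurExponent]
    simp [h0, hd]

theorem coeff_succ_schurExponent (n : ℕ) :
    PowerSeries.coeff (n + 1) schurExponent =
      (1 / ((n : ℂ) + 1)) • (MvPolynomial.X n.succPNat : MvPolynomial ℕ+ ℂ) := by
  rw [schurExponent, PowerSeries.coeff_mk, dif_pos n.succ_pos, Nat.cast_add_one]
  rfl

/-- Compare the coefficients of y^r in (exp f)' = exp(f) · f'. The denominators 1/n in f cancel
against differentiation, so f' = ∑ x_{m+1} y^m. In each pair, `p.1` is the degree of the smaller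
Schur polynomial and `p.2 + 1` the index of the variable. -/
theorem schurPoly_succ (r : ℕ) :
    ((r : ℂ) + 1) • schurPoly (r + 1) =
      ∑ p ∈ Finset.HasAntidiagonal.antidiagonal r, MvPolynomial.X p.2.succPNat * schurPoly p.1 := by
  have h1 := congrArg (PowerSeries.coeff r)
    (PowerSeries.derivative_subst (f := PowerSeries.exp (MvPolynomial ℕ+ ℂ))
      hasSubst_schurExponent)
  rw [PowerSeries.derivative_exp, PowerSeries.coeff_derivative, PowerSeries.coeff_mul] at h1
  have h2 : ((r : ℂ) + 1) • schurPoly (r + 1) =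
      schurPoly (r + 1) * ((r : MvPolynomial ℕ+ ℂ) + 1) := by
    rw [mul_comm, MvPolynomial.smul_eq_C_mul]
    simp
  rw [h2, schurPoly, h1]
  refine Finset.sum_congr rfl fun p _ => ?_
  rw [mul_comm, PowerSeries.coeff_derivative]
  congr 1
  have h3 : ((p.2 : ℂ) + 1) ≠ 0 := Nat.cast_add_one_ne_zero _
  have h4 : (p.2 : MvPolynomial ℕ+ ℂ) + 1 = MvPolynomial.C ((p.2 : ℂ) + 1) := by simp
  rw [coeff_succ_schurExponent, h4, mul_comm, MvPolynomial.C_mul', smul_smul,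
    mul_one_div_cancel h3, one_smul]

theorem evalAtModes_schurPoly_zero {H : Type*} [AddCommGroup H] [Module ℂ H] (h : H) :
    evalAtModes h (schurPoly 0) = 1 := by
  rw [schurPoly_zero, evalAtModes, map_one, hwVector, mul_one]

theorem evalAtModes_schurPoly_succ {H : Type*} [AddCommGroup H] [Module ℂ H] (h : H) (r : ℕ) :
    ((r : ℂ) + 1) • evalAtModes h (schurPoly (r + 1)) =
      ∑ p ∈ Finset.HasAntidiagonal.antidiagonal r,
        creator p.2.succPNat h * evalAtModes h (schurPoly p.1) := by
  rw [evalAtModes, ← smul_mul_assoc, ← map_smul, schurPoly_succ, map_sum, Finset.sum_mul]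
  refine Finset.sum_congr rfl fun p _ => ?_
  rw [map_mul, MvPolynomial.aeval_X, mul_assoc]
  rfl

/-- Induction for the vectors `p_r(h(-1), h(-2), …) 𝟏`. -/
theorem evalAtModes_schurPoly_induction {H : Type*} [AddCommGroup H] [Module ℂ H] {h : H}
    {motive : ℕ → Fock H → Prop} (one : motive 0 1)
    (step : ∀ r, (∀ i ≤ r, motive i (evalAtModes h (schurPoly i))) →
      motive (r + 1) (((r : ℂ) + 1)⁻¹ • ∑ p ∈ Finset.HasAntidiagonal.antidiagonal r,
        creator p.2.succPNat h * evalAtModes h (schurPoly p.1))) (r : ℕ) :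
    motive r (evalAtModes h (schurPoly r)) := by
  induction r using Nat.strong_induction_on with
  | _ r ih =>
    cases r with
    | zero => rw [evalAtModes_schurPoly_zero]; exact one
    | succ r =>
      have h3 : ((r : ℂ) + 1) ≠ 0 := Nat.cast_add_one_ne_zero _
      have := step r fun i hi => ih i (by omega)
      rwa [← evalAtModes_schurPoly_succ, inv_smul_smul₀ h3] at this

theorem succ_mul_choose (a : ℂ) (r : ℕ) :
    ((r : ℂ) + 1) * Ring.choose a (r + 1) = (a - r) * Ring.choose a r := by
  -- The identity C(n,k) C(a,n) = C(a,k) C(a-k,n-k) for n = r+1 and k = r, where C(n,k) = r+1 and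
  -- C(a-k,1) = a-r.
  have := Ring.choose_smul_choose a (Nat.le_succ r)
  rw [Nat.choose_succ_self_right, Nat.succ_eq_add_one, Nat.add_sub_cancel_left,
    Ring.choose_one_right, nsmul_eq_mul] at this
  push_cast at this
  rw [this, mul_comm]

/-- The Schur recursion specialised to x_n = (-1)^{n-1} a. In the induction, the terms with `p.2 >
0` are the previous sum with its sign flipped, and the term `p.2 = 0` supplies a C(a, r+1); together
they are (a - (r+1)) C(a, r+1). -/
theorem sum_antidiagonal_choose (a : ℂ) (r : ℕ) :
    ∑ p ∈ Finset.HasAntidiagonal.antidiagonal r, (-1) ^ p.2 * a * Ring.choose a p.1 =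
      ((r : ℂ) + 1) * Ring.choose a (r + 1) := by
  induction r with
  | zero => simp
  | succ r ih =>
    have h1 : ∑ p ∈ Finset.HasAntidiagonal.antidiagonal r, (-1) ^ (p.2 + 1) * a * Ring.choose a p.1 =
        -∑ p ∈ Finset.HasAntidiagonal.antidiagonal r, (-1) ^ p.2 * a * Ring.choose a p.1 := by
      rw [← Finset.sum_neg_distrib]
      exact Finset.sum_congr rfl fun p _ => by ring
    rw [Finset.Nat.sum_antidiagonal_succ', h1, ih, succ_mul_choose a (r + 1)]
    push_cast
    ring

/-- The mode h(0) acts by ⟨h, λ⟩, while the binomial coefficient is stated in ⟨λ, h⟩; this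
reconciles the two. -/
theorem baseChange_symm {L : Type*} [AddCommGroup L] {form : LinearMap.BilinForm ℤ L}
    (hsymm : form.IsSymm) (x y : ℂ ⊗[ℤ] L) :
    form.baseChange ℂ x y = form.baseChange ℂ y x := by
  induction x using TensorProduct.induction_on with
  | zero => simp
  | add x x' hx hx' => rw [map_add, map_add, LinearMap.add_apply, hx, hx']
  | tmul a l =>
    induction y using TensorProduct.induction_on with
    | zero => simp
    | add y y' hy hy' => rw [map_add, map_add, LinearMap.add_apply, hy, hy']
    | tmul c m =>
      rw [LinearMap.BilinForm.baseChange_tmul, LinearMap.BilinForm.baseChange_tmul, hsymm.eq l m,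
        mul_comm a c]

section Fock

variable {H : Type*} [AddCommGroup H] [Module ℂ H]

/-! ## The top coefficient of a vertex operator on the highest weight vector -/

theorem fieldDeriv_pow_ncoeff {M : Type*} [AddCommGroup M] [Module ℂ M]
    (A : VertexOperator ℂ M) (m : ℕ) (n : ℤ) :
    ((fieldDeriv ^ m) A)[[n]] = (∏ i ∈ Finset.range m, (-((n : ℂ) - i))) • A[[n - m]] := by
  induction m generalizing n with
  | zero => simp
  | succ m ih =>
    -- The outermost derivative contributes the factor -n, which is the one with `i = 0`; the
    -- induction hypothesis at n - 1 supplies the others after the shift i ↦ i + 1.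
    rw [pow_succ', Module.End.mul_apply, fieldDeriv_apply, ih, smul_smul,
      Finset.prod_range_succ', mul_comm]
    have h1 : ∏ i ∈ Finset.range m, (-(((n - 1 : ℤ) : ℂ) - i)) =
        ∏ i ∈ Finset.range m, (-((n : ℂ) - ((i + 1 : ℕ) : ℂ))) :=
      Finset.prod_congr rfl fun i _ => by push_cast; ring
    rw [h1, show n - 1 - (m : ℤ) = n - ((m + 1 : ℕ) : ℤ) by push_cast; ring, Nat.cast_zero,
      sub_zero]

theorem dividedDeriv_ncoeff {M : Type*} [AddCommGroup M] [Module ℂ M]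
    (A : VertexOperator ℂ M) (m : ℕ) (n : ℤ) :
    (dividedDeriv m A)[[n]] =
      ((m.factorial : ℂ)⁻¹ * ∏ i ∈ Finset.range m, (-((n : ℂ) - i))) • A[[n - m]] := by
  rw [dividedDeriv, LinearMap.smul_apply, map_smul, Pi.smul_apply, fieldDeriv_pow_ncoeff,
    smul_smul]

/-- The coefficient is a multiple of h(j - m). For j < m the multiple is zero, its product having a
factor with i = j; for j > m the operator annihilates the highest weight vector. For j = m the
product is (-1)^m m!, whose factorial cancels, and h(0) is a scalar. -/
theorem dividedDeriv_heisField_one (B : LinearMap.BilinForm ℂ H) (lam h : H) (m j : ℕ) :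
    ((dividedDeriv m (heisField B lam h))[[(j : ℤ)]]) 1 =
      (if j = m then (-1) ^ m * B h lam else 0) • (1 : Fock H) := by
  rw [dividedDeriv_ncoeff, heisField_ncoeff, LinearMap.smul_apply]
  rcases lt_trichotomy j m with hj | rfl | hj
  · rw [if_neg hj.ne, Finset.prod_eq_zero (Finset.mem_range.2 hj) (by simp), mul_zero, zero_smul,
      zero_smul]
  · have h1 : ∏ i ∈ Finset.range j, (-(((j : ℤ) : ℂ) - i)) = (-1) ^ j * (j.factorial : ℂ) := by
      rw [Finset.prod_neg, Finset.card_range, ← Finset.prod_range_add_one_eq_factorial,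
        ← Finset.prod_range_reflect]
      push_cast
      congr 1
      refine Finset.prod_congr rfl fun i hi => ?_
      have := Finset.mem_range.1 hi
      rw [Nat.cast_sub (by omega), Nat.cast_sub (by omega)]
      push_cast
      ring
    have h2 : (j.factorial : ℂ) ≠ 0 := Nat.cast_ne_zero.2 j.factorial_ne_zero
    rw [h1, if_pos rfl, sub_self, mode_zero, smul_smul]
    congr 1
    field_simp
  · obtain ⟨k, hk⟩ : ∃ k : ℕ+, (j : ℤ) - m = k := ⟨⟨j - m, by omega⟩, by simp; omega⟩
    rw [hk, mode_pos, annihilator_one, smul_zero, if_neg (by omega), zero_smul]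

/-- On the highest weight vector, `u_n` vanishes for `n ≥ s`, and `u_{s-1}` is the scalar `c`. -/
def HasTopCoeff (B : LinearMap.BilinForm ℂ H) (lam : H) (s : ℕ) (c : ℂ) (u : Fock H) : Prop :=
  (∀ n : ℤ, (s : ℤ) ≤ n → ((vertexOp B lam u)[[n]]) 1 = 0) ∧
    ((vertexOp B lam u)[[(s : ℤ) - 1]]) 1 = c • 1

theorem hasTopCoeff_one (B : LinearMap.BilinForm ℂ H) (lam : H) : HasTopCoeff B lam 0 1 1 := by
  refine ⟨fun n hn => ?_, ?_⟩
  · rw [vertexOp_one, idField_ncoeff, if_neg (by push_cast at hn; omega), LinearMap.zero_apply]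
  · rw [vertexOp_one, idField_ncoeff, if_pos (by simp), one_smul, Module.End.one_apply]

theorem HasTopCoeff.smul {B : LinearMap.BilinForm ℂ H} {lam : H} {s : ℕ} {c : ℂ} {u : Fock H}
    (hu : HasTopCoeff B lam s c u) (d : ℂ) : HasTopCoeff B lam s (d * c) (d • u) := by
  refine ⟨fun n hn => ?_, ?_⟩ <;>
    rw [map_smul, map_smul, Pi.smul_apply, LinearMap.smul_apply]
  · rw [hu.1 n hn, smul_zero]
  · rw [hu.2, smul_smul]

theorem HasTopCoeff.sum {ι : Type*} {B : LinearMap.BilinForm ℂ H} {lam : H} {s : ℕ}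
    (t : Finset ι) {c : ι → ℂ} {u : ι → Fock H}
    (hu : ∀ i ∈ t, HasTopCoeff B lam s (c i) (u i)) :
    HasTopCoeff B lam s (∑ i ∈ t, c i) (∑ i ∈ t, u i) := by
  refine ⟨fun n hn => ?_, ?_⟩ <;>
    rw [map_sum, map_sum, Finset.sum_apply, LinearMap.sum_apply]
  · exact Finset.sum_eq_zero fun i hi => (hu i hi).1 n hn
  · rw [Finset.sum_smul]
    exact Finset.sum_congr rfl fun i hi => (hu i hi).2

theorem HasTopCoeff.creator_mul {B : LinearMap.BilinForm ℂ H} {lam : H} {s : ℕ} {c : ℂ}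
    {u : Fock H} (hu : HasTopCoeff B lam s c u) (m : ℕ) (h : H) :
    HasTopCoeff B lam (s + (m + 1)) ((-1) ^ m * B h lam * c) (creator m.succPNat h * u) := by
  -- The range n ≥ s, wider than the vanishing range n ≥ s + m + 1, includes the top index n = s +
  -- m, where n - 1 - m = s - 1.
  have key : ∀ n : ℤ, (s : ℤ) ≤ n → ((vertexOp B lam (creator m.succPNat h * u))[[n]]) 1 =
      ((-1) ^ m * B h lam) • ((vertexOp B lam u)[[n - 1 - m]]) 1 := by
    intro n hn
    -- The cutoffs are 0 and m + 1: the creation sum is empty because u_{n+i} kills the vector for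
    -- all i ≥ 0, and in the annihilation sum only j = m survives.
    rw [vertexOp_creator_mul, Nat.succPNat_coe, Nat.succ_eq_add_one, Nat.add_sub_cancel,
      normalOrder_apply, normalOrderCoeff_eq _ _ n 1 0 (m + 1)
        (fun i _ => hu.1 _ (by omega))
        (fun j hj => by
          rw [dividedDeriv_heisField_one, if_neg (by omega), zero_smul]),
      Finset.range_zero, Finset.sum_empty, zero_add,
      Finset.sum_eq_single_of_mem m (Finset.self_mem_range_succ m)]
    · rw [dividedDeriv_heisField_one, if_pos rfl, map_smul]
    · intro j _ hj
      rw [dividedDeriv_heisField_one, if_neg hj, zero_smul, map_zero]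
  refine ⟨fun n hn => ?_, ?_⟩
  · rw [key n (by omega), hu.1 _ (by push_cast at hn; omega), smul_zero]
  · rw [key _ (by push_cast; omega),
      show ((s + (m + 1) : ℕ) : ℤ) - 1 - 1 - m = s - 1 by push_cast; ring, hu.2, smul_smul]

theorem hasTopCoeff_schurPoly (B : LinearMap.BilinForm ℂ H) (lam h : H) (r : ℕ) :
    HasTopCoeff B lam r (Ring.choose (B h lam) r) (evalAtModes h (schurPoly r)) := by
  refine evalAtModes_schurPoly_induction
    (motive := fun r u => HasTopCoeff B lam r (Ring.choose (B h lam) r) u) ?_ ?_ r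
  · rw [Ring.choose_zero_right]
    exact hasTopCoeff_one B lam
  · intro r ih
    have h3 : ((r : ℂ) + 1) ≠ 0 := Nat.cast_add_one_ne_zero _
    -- Brings the scalar into the shape of the vector, (r+1)⁻¹ times a sum over the antidiagonal, so
    -- that the two can be matched term by term.
    rw [← inv_mul_cancel_left₀ h3 (Ring.choose (B h lam) (r + 1)), ← sum_antidiagonal_choose]
    refine (HasTopCoeff.sum _ fun p hp => ?_).smul _
    have hp' := Finset.HasAntidiagonal.mem_antidiagonal.1 hp
    have := (ih p.1 (by omega)).creator_mul p.2 h
    rwa [← add_assoc, hp'] at this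

/-! ## The grading of `M(1)` -/

/-- The identity field has its only coefficient at index -1. It therefore selects one term of the
creation sum if n < 0 and one term of the annihilation sum if n ≥ 0, the other sum being zero. -/
theorem normalOrder_idField (A : VertexOperator ℂ (Fock H)) : normalOrder A idField = A := by
  apply field_ext
  intro n v
  rw [normalOrder_apply, normalOrderCoeff]
  simp only [idField_ncoeff]
  rcases lt_or_ge n 0 with hn | hn
  · have h1 : ∀ j : ℕ, n - 1 - (j : ℤ) ≠ -1 := fun j => by omega
    rw [finsum_eq_single _ (-1 - n).toNat]
    · have h2 : n + ((-1 - n).toNat : ℤ) = -1 := by omega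
      have h3 : -1 - ((-1 - n).toNat : ℤ) = n := by omega
      rw [h2, h3]
      simp [h1]
    · intro i hi
      rw [if_neg (by omega), LinearMap.zero_apply, map_zero]
  · have h1 : ∀ j : ℕ, n + (j : ℤ) ≠ -1 := fun j => by omega
    rw [finsum_eq_single (fun j : ℕ => (if n - 1 - (j : ℤ) = -1 then
      (1 : Module.End ℂ (Fock H)) else 0) ((A[[(j : ℤ)]]) v)) n.toNat]
    · have h2 : (n.toNat : ℤ) = n := by omega
      simp [h1, h2]
    · intro i hi
      rw [if_neg (by omega), LinearMap.zero_apply]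

theorem vertexOp_creator_one_sq (B : LinearMap.BilinForm ℂ H) (lam h : H) :
    vertexOp B lam (creator 1 h * (creator 1 h * hwVector H)) =
      normalOrder (heisField B lam h) (heisField B lam h) := by
  rw [vertexOp_creator_mul, vertexOp_creator_mul, hwVector, vertexOp_one, normalOrder_idField]
  simp [dividedDeriv]

/-- The operator `½ :h(z)h(z):₁` on `M(1)` is `∑_{n ≥ 1} h(-n) h(n)`. -/
theorem half_normalOrder_sq (B : LinearMap.BilinForm ℂ H) (h : H) (v : Fock H) (K : ℕ)
    (hK : ∀ n : ℕ+, K < n → annihilator B n h v = 0) :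
    (1 / 2 : ℂ) • ((normalOrder (heisField B 0 h) (heisField B 0 h))[[1]]) v =
      ∑ n ∈ Finset.range K, creator n.succPNat h * annihilator B n.succPNat h v := by
  have hpos : ∀ n : ℕ, mode B 0 ((n : ℤ) + 1) h v = annihilator B n.succPNat h v := fun n => by
    rw [← mode_pos B 0, Nat.succPNat_coe, Nat.succ_eq_add_one, Nat.cast_add, Nat.cast_one]
  have hneg : ∀ (n : ℕ) (w : Fock H), mode B 0 (-1 - (n : ℤ)) h w = creator n.succPNat h * w :=
    fun n w => by
      rw [← mode_neg B 0, Nat.succPNat_coe, Nat.succ_eq_add_one, Nat.cast_add, Nat.cast_one,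
        neg_add, sub_eq_add_neg, add_comm]
  have hzero : ∀ n : ℕ, K ≤ n → mode B 0 ((n : ℤ) + 1) h v = 0 := fun n hn => by
    rw [hpos, hK _ (by rw [Nat.succPNat_coe]; omega)]
  -- The annihilation sum gets one more term than the creation sum, for j = 0. That term vanishes
  -- because h(0) acts by ⟨h, 0⟩ = 0 on M(1); after the shift j = n + 1 the two sums agree and
  -- absorb the factor ½.
  rw [normalOrder_apply, normalOrderCoeff_eq _ _ 1 v K (K + 1)
    (fun i hi => by rw [heisField_ncoeff, add_comm, hzero i hi])
    (fun j hj => by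
      rw [heisField_ncoeff]
      obtain ⟨i, rfl⟩ : ∃ i, j = i + 1 := ⟨j - 1, by omega⟩
      rw [Nat.cast_add, Nat.cast_one, hzero i (by omega)]),
    Finset.sum_range_succ']
  simp only [heisField_ncoeff, Nat.cast_zero, mode_zero, map_zero, zero_smul, add_zero]
  rw [← Finset.sum_add_distrib, Finset.smul_sum]
  refine Finset.sum_congr rfl fun n _ => ?_
  rw [show (1 : ℤ) - 1 - ((n + 1 : ℕ) : ℤ) = -1 - (n : ℤ) by push_cast; ring, add_comm (1 : ℤ),
    Nat.cast_add, Nat.cast_one, hpos, hneg, ← two_smul ℂ, smul_smul]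
  norm_num

/-- The sum over n is finite only on each vector. Leaving the cutoff `K` free lets two vectors be
compared with a common one. -/
theorem L0_apply (B : LinearMap.BilinForm ℂ H) {d : ℕ} (b : Module.Basis (Fin d) ℂ H)
    (v : Fock H) (K : ℕ) (hK : ∀ n : ℕ+, K < n → ∀ h, annihilator B n h v = 0) :
    L0 B b v = ∑ i, ∑ n ∈ Finset.range K,
      creator n.succPNat (b i) * annihilator B n.succPNat (b i) v := by
  rw [L0, conformalVector, map_smul, map_sum, map_smul, Pi.smul_apply, LinearMap.smul_apply,
    map_sum, Finset.sum_apply, LinearMap.sum_apply, Finset.smul_sum]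
  refine Finset.sum_congr rfl fun i _ => ?_
  rw [vertexOp_creator_one_sq, half_normalOrder_sq B (b i) v K fun n hn => hK n hn _]

theorem L0_one (B : LinearMap.BilinForm ℂ H) {d : ℕ} (b : Module.Basis (Fin d) ℂ H) :
    L0 B b 1 = 0 := by
  rw [L0_apply B b 1 0 fun n _ h => annihilator_one B n h]
  simp

/-! ### The commutator of L₀ with creation operators -/

theorem sum_bilin_smul_of_orthonormal (B : LinearMap.BilinForm ℂ H) {d : ℕ}
    (b : Module.Basis (Fin d) ℂ H) (hb : ∀ i j, B (b i) (b j) = if i = j then 1 else 0) (h : H) :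
    ∑ i, B (b i) h • b i = h := by
  conv_rhs => rw [← b.sum_repr h]
  refine Finset.sum_congr rfl fun i _ => ?_
  have h1 : B (b i) (∑ j, b.repr h j • b j) = b.repr h i := by
    simp only [map_sum, map_smul, hb, smul_eq_mul, mul_ite, mul_one, mul_zero,
      Finset.sum_ite_eq, Finset.mem_univ, if_true]
  rw [b.sum_repr] at h1
  rw [h1]

/-- `[L₀, h(-k)] = k h(-k)`. -/
theorem L0_creator_mul (B : LinearMap.BilinForm ℂ H) {d : ℕ} (b : Module.Basis (Fin d) ℂ H)
    (hb : ∀ i j, B (b i) (b j) = if i = j then 1 else 0) (k : ℕ) (h : H) (v : Fock H) :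
    L0 B b (creator k.succPNat h * v) =
      creator k.succPNat h * L0 B b v + ((k : ℂ) + 1) • (creator k.succPNat h * v) := by
  obtain ⟨N, hN⟩ := annihilator_trunc B v
  have hk : (k.succPNat : ℕ) = k + 1 := rfl
  -- Beyond `N` the annihilators kill v, and beyond k + 1 they commute with h(-k-1); so `N + k + 1`
  -- is a cutoff for both vectors.
  have hK : ∀ n : ℕ+, N + k + 1 < n → ∀ g, annihilator B n g (creator k.succPNat h * v) = 0 := by
    intro n hn g
    have hne : n ≠ k.succPNat := by rintro rfl; omega
    rw [annihilator_creator_mul, hN n (by omega), if_neg hne, mul_zero, zero_smul, add_zero]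
  rw [L0_apply B b _ _ hK, L0_apply B b v (N + k + 1) fun n hn g => hN n (by omega) g,
    Finset.mul_sum]
  -- Expanding h in the orthonormal basis gives exactly the contractions of h_i(k+1) with h(-k-1),
  -- summed over i.
  have h1 : ((k : ℂ) + 1) • (creator k.succPNat h * v) =
      ∑ i, (((k : ℂ) + 1) * B (b i) h) • (creator k.succPNat (b i) * v) := by
    conv_lhs => rw [← sum_bilin_smul_of_orthonormal B b hb h]
    rw [map_sum, Finset.sum_mul, Finset.smul_sum]
    refine Finset.sum_congr rfl fun i _ => ?_
    rw [map_smul, smul_mul_assoc, smul_smul]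
  rw [h1, ← Finset.sum_add_distrib]
  refine Finset.sum_congr rfl fun i _ => ?_
  simp only [annihilator_creator_mul, mul_add, Finset.sum_add_distrib]
  congr 1
  · rw [Finset.mul_sum]
    exact Finset.sum_congr rfl fun n _ => mul_left_comm _ _ _
  -- Only h_i(n+1) with n = k has a nonzero commutator with h(-k-1).
  · rw [Finset.sum_eq_single_of_mem k (Finset.mem_range.2 (by omega))]
    · rw [if_pos rfl, mul_smul_comm, hk, Nat.cast_add, Nat.cast_one]
    · intro n _ hn
      rw [if_neg fun h0 => hn (Nat.succPNat_injective h0), zero_smul, mul_zero]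

theorem creator_mul_mem_gradedPart {B : LinearMap.BilinForm ℂ H} {d : ℕ}
    {b : Module.Basis (Fin d) ℂ H} (hb : ∀ i j, B (b i) (b j) = if i = j then 1 else 0)
    {s : ℕ} {u : Fock H} (hu : u ∈ gradedPart B b s) (k : ℕ) (h : H) :
    creator k.succPNat h * u ∈ gradedPart B b (s + k + 1) := by
  rw [gradedPart, Module.End.mem_eigenspace_iff] at hu ⊢
  rw [L0_creator_mul B b hb, hu, mul_smul_comm, ← add_smul]
  push_cast
  rw [add_assoc]

theorem evalAtModes_schurPoly_mem_gradedPart {B : LinearMap.BilinForm ℂ H} {d : ℕ}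
    {b : Module.Basis (Fin d) ℂ H} (hb : ∀ i j, B (b i) (b j) = if i = j then 1 else 0)
    (h : H) (r : ℕ) : evalAtModes h (schurPoly r) ∈ gradedPart B b r := by
  refine evalAtModes_schurPoly_induction (motive := fun r u => u ∈ gradedPart B b r) ?_ ?_ r
  · rw [gradedPart, Module.End.mem_eigenspace_iff, L0_one, Nat.cast_zero, zero_smul]
  · intro r ih
    refine Submodule.smul_mem _ _ (Submodule.sum_mem _ fun p hp => ?_)
    have hp' := Finset.HasAntidiagonal.mem_antidiagonal.1 hp
    rw [← hp']
    exact creator_mul_mem_gradedPart hb (ih p.1 (by omega)) p.2 h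

end Fock

end HeisenbergVOA

/-! ### The proposition for the complexified lattice -/

theorem proposition4p3
    {L : Type*} [AddCommGroup L] [Module.Free ℤ L] [Module.Finite ℤ L]
    (form : LinearMap.BilinForm ℤ L) (hsymm : form.IsSymm) (hnondeg : form.Nondegenerate)
    (lam h : ℂ ⊗[ℤ] L) (r : ℕ) :
    (∀ (d : ℕ) (b : Module.Basis (Fin d) ℂ (ℂ ⊗[ℤ] L)),
      (∀ i j, form.baseChange ℂ (b i) (b j) = if i = j then 1 else 0) →
        evalAtModes h (schurPoly r) ∈ gradedPart (form.baseChange ℂ) b r) ∧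
    (∀ n : ℤ, (r : ℤ) - 1 < n →
      ((vertexOp (form.baseChange ℂ) lam (evalAtModes h (schurPoly r)))[[n]])
        (hwVector (ℂ ⊗[ℤ] L)) = 0) ∧
    ((vertexOp (form.baseChange ℂ) lam (evalAtModes h (schurPoly r)))[[(r : ℤ) - 1]])
        (hwVector (ℂ ⊗[ℤ] L)) =
      Ring.choose (form.baseChange ℂ lam h) r • hwVector (ℂ ⊗[ℤ] L) := by
  have hB : form.baseChange ℂ h lam = form.baseChange ℂ lam h :=
    baseChange_symm hsymm h lam
  obtain ⟨h1, h2⟩ := hasTopCoeff_schurPoly (form.baseChange ℂ) lam h r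
  refine ⟨fun d b hb => evalAtModes_schurPoly_mem_gradedPart hb h r,
    fun n hn => h1 n (by omega), ?_⟩
  rw [← hB]
  exact h2
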